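/- **Setting.** Consider the linear system $x_{t+1}=Ax_t+Bu_t+w_t$, $y_t=Cx_t+e_t$, $t\ge 1$, with a given initial state and arbitrary fixed disturbances $(w_t),(e_t)$, and losses $\ell_t(v)$ of $v=(y,u)\in\mathbb R^{d_y+d_u}$ that are $L$-subquadratic: $0\le \ell_t(v)\le L\max\{1,\|v\|^2\}$ and $|\ell_t(v)-\ell_t(v')|\le L\max\{1,\|v\|,\|v'\|\}\,\|v-v'\|$ (for differentiable $\ell_t$ the last condition follows from $\|\nabla\ell_t(v)\|\le L\max\{1,\|v\|\}$). A nominal dynamic controller $\pi_0$ is driven by exogenous inputs $u^{\rm ex}_t$ and returns features $\eta_t\in\mathbb R^{d_\eta}$: $$s_{t+1}=A_0s_t+B_0y_t+B_{0,u}u^{\rm ex}_t,\quad u_t=C_0s_t+D_0y_t+u^{\rm ex}_t,\quad \eta_t=C_{0,\eta}s_t+D_{0,\eta}y_t,\quad s_1=0.$$ Let $v_t^{\rm nat}=(y_t^{\rm nat},u_t^{\rm nat})$ and $\eta_t^{\rm nat}$ be the sequences obtained with $u^{\rm ex}\equiv0$, and let $G_{{\rm ex}\to v},G_{{\rm ex}\to\eta}$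 be the Markov operators (impulse responses) from $u^{\rm ex}$ to $v$ and to $\eta$. For a Markov operator $G=(G^{[i]})_{i\ge0}$ put $\|G\|_{\ell_1,\rm op}=\sum_{i\ge 0}\|G^{[i]}\|_{\rm op}$ and $\psi_G(n)=\sum_{i\ge n}\|G^{[i]}\|_{\rm op}$. Assume that $\|G_{{\rm ex}\to v}\|_{\ell_1,\rm op}$ and $\|G_{{\rm ex}\to\eta}\|_{\ell_1,\rm op}$ are at most $R_{\pi_0}<\infty$, that $\psi_{G_{{\rm ex}\to v}},\psi_{G_{{\rm ex}\to \eta}}\le\psi_{\pi_0}$ pointwise, where $\psi_{\pi_0}:\mathbb N\to[0,\infty)$ is non-increasing, and that $\|v_t^{\rm nat}\|,\|\eta_t^{\rm nat}\|\le R_{\rm nat}$ for all $t\ge1$. **Algorithm.** Let $\mathcal M=\{(M^{[0]},\dots,M^{[m-1]}):M^{[i]}\in\mathbb R^{d_u\times d_\eta},\ \sum_{i<m}\|M^{[i]}\|_{\rm op}\le R_{\mathcal M}\}$ and $u^{\rm ex}_t(M\mid\eta_{1:t})=\sum_{i=0}^{m-1}M^{[i]}\eta_{t-i}$, with $\eta_s:=0$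 for $s\le0$. In round $t$ the algorithm observes $y_t,\eta_t$, forms $\hat\eta_t=\eta_t-\sum_{i=1}^{t-1}G_{{\rm ex}\to\eta}^{[i]}u^{\rm ex}_{t-i}$ using the exact Markov operator, and plays $\pi_0$ with exogenous input $u^{\rm ex}_t=u^{\rm ex}_t(\mathbf M_t\mid\hat\eta_{1:t})$, where $\mathbf M_t\in\mathcal M$ are iterates of an arbitrary black-box procedure. This produces outputs $v_t^{\rm alg}$. **Benchmark.** A linear dynamic controller (LDC) $\pi$, given by $s_{t+1}=A_\pi s_t+B_\pi y_t$, $u_t=C_\pi s_t+D_\pi y_t$, $s_1=0$, with internal state of any dimension, produces outputs $v_t^\pi$ in closed loop. A conversion operator for $\pi$ is a Markov operator $G$ with $v_t^\pi=v_t^{\rm nat}+\sum_{i=1}^tG_{{\rm ex}\to v}^{[t-i]}\sum_{j=1}^iG^{[i-j]}\eta_j^{\rm nat}$ for all $t\ge1$. Let $\Pi_\star$ be the set of LDCs that have a conversion operator $G$ with $\|G\|_{\ell_1,\rm op}\le R_\star$ and $\psi_G\le\psi_\star$ pointwise, where $\psi_\star:\mathbb N\to[0,\infty)$ is non-increasing,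 and let $$\mathrm{ControlReg}_T=\sum_{t=1}^T\ell_t(v_t^{\rm alg})-\inf_{\pi\in\Pi_\star}\sum_{t=1}^T\ell_t(v_t^\pi).$$ **Memory regret.** Let $\mathfrak e(M)\in\mathbb R^{m d_u d_\eta}$ list the entries of $M$, let $\mathcal M_{\mathfrak e}=\mathfrak e(\mathcal M)$ and $\mathbf z_t=\mathfrak e(\mathbf M_t)$, and let $\mathbf Y_t$ be the matrix with $\mathbf Y_t\,\mathfrak e(M)=u^{\rm ex}_t(M\mid\eta^{\rm nat}_{1:t})$ for all $M$ ($\mathbf Y_s=0$ for $s\le0$). Put $F_t(z_{t:t-h})=\ell_t\big(v_t^{\rm nat}+\sum_{i=0}^hG_{{\rm ex}\to v}^{[i]}\mathbf Y_{t-i}z_{t-i}\big)$, $f_t(z)=F_t(z,\dots,z)$, and $$\mathrm{MemoryReg}_T=\sum_{t=1}^TF_t(\mathbf z_{t:t-h})-\inf_{z\in\mathcal M_{\mathfrak e}}\sum_{t=1}^Tf_t(z).$$ **Claim.** Let $T\ge1$, $m,h\ge0$ be integers, $R_{\rm nat}\ge1$, $R_{\mathcal M}\ge1$, $R_{\mathcal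 M}\ge R_\star$, and suppose that $\psi_\star(m)\le cR_\star/T$ and $\psi_{\pi_0}(h+1)\le cR_{\pi_0}/T$ for some $c>0$. Then $$\mathrm{ControlReg}_T\le\mathrm{MemoryReg}_T+12\,L\,c\,R_{\mathcal M}^2R_{\pi_0}^2R_{\rm nat}^2 .$$ The same holds for the static-feedback algorithm, in which $u_t=Ky_t+u^{\rm ex}_t$, the features are the measurements $\eta_t=y_t$, $G_{{\rm ex}\to v}$ is the Markov operator $G_K$ of the closed loop with $K$ (satisfying $\|G_K\|_{\ell_1,\rm op}\le R_{\pi_0}$ and $\psi_{G_K}\le\psi_{\pi_0}$), $G_{{\rm ex}\to\eta}$ consists of the $y$-rows of $G_K$, and $v^{\rm nat}_t=(y^K_t,Ky^K_t)$ satisfies $\|v^{\rm nat}_t\|\le R_{\rm nat}$. -/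

import Mathlib

open scoped Matrix.Norms.L2Operator ENNReal

noncomputable section

namespace DRC

/-! Rounds are indexed by `t = 0, 1, 2, …`; the horizon `T` consists of the rounds
`t ∈ Finset.range T`.  Signals are Euclidean vectors, and the norm `‖A‖` of a matrix is its
(Euclidean) operator norm. -/

/-- The space `ℝⁿ` with its Euclidean norm. -/
abbrev Vec (n : ℕ) : Type := EuclideanSpace ℝ (Fin n)

/-- The space of pairs `(y, u)`, with the Euclidean norm of the concatenated vector. -/
abbrev OutVec (dy du : ℕ) : Type := EuclideanSpace ℝ (Fin dy ⊕ Fin du)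

/-- Matrix-vector product on Euclidean vectors. -/
abbrev act {ι κ : Type*} [Fintype ι] [DecidableEq ι] [Fintype κ] [DecidableEq κ]
    (A : Matrix ι κ ℝ) (x : EuclideanSpace ℝ κ) : EuclideanSpace ℝ ι :=
  Matrix.toEuclideanLin A x

/-- The concatenation `(y, u)`. -/
def stack {dy du : ℕ} (y : Vec dy) (u : Vec du) : OutVec dy du :=
  WithLp.toLp 2 (Sum.elim (fun i => y i) (fun j => u j))

/-! ### Losses -/

/-- `L`-subquadratic losses: `0 ≤ ℓ(v) ≤ L max{1, ‖v‖²}`, and on every ball of radius `R ≥ 1`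
about the origin `ℓ` is `L R`-Lipschitz.  For differentiable `ℓ` the last condition follows
from `‖∇ ℓ(v)‖ ≤ L max{1, ‖v‖}`, see `isSubquadratic_of_gradient`. -/
structure IsSubquadratic {E : Type*} [NormedAddCommGroup E] (L : ℝ) (ℓ : E → ℝ) : Prop where
  nonneg : ∀ v, 0 ≤ ℓ v
  le : ∀ v, ℓ v ≤ L * max 1 (‖v‖ ^ 2)
  lipschitz : ∀ v v', |ℓ v - ℓ v'| ≤ L * max 1 (max ‖v‖ ‖v'‖) * ‖v - v'‖

theorem isSubquadratic_of_gradient {E : Type*} [NormedAddCommGroup E] [InnerProductSpace ℝ E]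
    [CompleteSpace E] {L : ℝ} {ℓ : E → ℝ} (h0 : ∀ v, 0 ≤ ℓ v)
    (h1 : ∀ v, ℓ v ≤ L * max 1 (‖v‖ ^ 2)) (hd : Differentiable ℝ ℓ)
    (hg : ∀ v, ‖gradient ℓ v‖ ≤ L * max 1 ‖v‖) : IsSubquadratic L ℓ := by
  have hL : 0 ≤ L := by
    have h := (h0 0).trans (h1 0)
    simpa using h
  refine ⟨h0, h1, fun v v' => ?_⟩
  have key := (convex_closedBall (0 : E) (max ‖v‖ ‖v'‖)).norm_image_sub_le_of_norm_fderiv_le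
    (𝕜 := ℝ) (f := ℓ) (C := L * max 1 (max ‖v‖ ‖v'‖)) (x := v') (y := v)
    (fun x _ => hd x) (fun x hx => ?_) (by simp) (by simp)
  · simpa [Real.norm_eq_abs] using key
  · have hx' : ‖x‖ ≤ max ‖v‖ ‖v'‖ := by simpa using hx
    have h2 : ‖fderiv ℝ ℓ x‖ = ‖gradient ℓ x‖ := by
      rw [gradient, LinearIsometryEquiv.norm_map]
    rw [h2]
    exact (hg x).trans (mul_le_mul_of_nonneg_left (max_le_max le_rfl hx') hL)

/-! ### Markov operators -/

/-- A Markov operator `G = (G^{[i]})_{i ≥ 0}`. -/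
abbrev Markov (ι κ : Type*) : Type _ := ℕ → Matrix ι κ ℝ

section Markov

variable {ι κ : Type*} [Fintype ι] [DecidableEq ι] [Fintype κ] [DecidableEq κ]

/-- The `ℓ₁,op` norm `∑_{i ≥ 0} ‖G^{[i]}‖`. -/
def l1op (G : Markov ι κ) : ℝ≥0∞ := ∑' i, ENNReal.ofReal ‖G i‖

/-- The decay function `ψ_G(n) = ∑_{i ≥ n} ‖G^{[i]}‖`. -/
def decay (G : Markov ι κ) (n : ℕ) : ℝ≥0∞ := ∑' i, ENNReal.ofReal ‖G (n + i)‖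

/-- The response `∑_{i ≤ t} G^{[t-i]} u_i` of a Markov operator to the inputs `u`. -/
def response (G : Markov ι κ) (u : ℕ → EuclideanSpace ℝ κ) (t : ℕ) : EuclideanSpace ℝ ι :=
  ∑ i ∈ Finset.range (t + 1), act (G (t - i)) (u i)

end Markov

/-- Proper, stable decay functions (real valued, so that `ψ 0 < ∞`). -/
structure IsDecayFunction (ψ : ℕ → ℝ) : Prop where
  nonneg : ∀ n, 0 ≤ ψ n
  antitone : Antitone ψ

/-! ### The plant and the linear dynamic controllers -/

/-- The system `x_{t+1} = A x_t + B u_t + w_t`, `y_t = C x_t + e_t`, with its initial state and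
its (fixed, arbitrary) disturbances `w`, `e`. -/
structure Plant (dx du dy : ℕ) where
  A : Matrix (Fin dx) (Fin dx) ℝ
  B : Matrix (Fin dx) (Fin du) ℝ
  C : Matrix (Fin dy) (Fin dx) ℝ
  x₀ : Vec dx
  w : ℕ → Vec dx
  e : ℕ → Vec dy

/-- A linear dynamic controller `s_{t+1} = A s_t + B y_t`, `u_t = C s_t + D y_t`. -/
structure LDC (dy du : ℕ) where
  dim : ℕ
  A : Matrix (Fin dim) (Fin dim) ℝ
  B : Matrix (Fin dim) (Fin dy) ℝ
  C : Matrix (Fin du) (Fin dim) ℝ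
  D : Matrix (Fin du) (Fin dy) ℝ

/-- A nominal controller `π₀` driven by exogenous inputs `uᵉˣ` and returning features `η`:
`s_{t+1} = A s_t + B y_t + Bᵤ uᵉˣ_t`, `u_t = C s_t + D y_t + uᵉˣ_t`, `η_t = C_η s_t + D_η y_t`. -/
structure NominalController (dy du dη : ℕ) where
  dim : ℕ
  A : Matrix (Fin dim) (Fin dim) ℝ
  B : Matrix (Fin dim) (Fin dy) ℝ
  Bu : Matrix (Fin dim) (Fin du) ℝ
  C : Matrix (Fin du) (Fin dim) ℝ
  D : Matrix (Fin du) (Fin dy) ℝ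
  Cη : Matrix (Fin dη) (Fin dim) ℝ
  Dη : Matrix (Fin dη) (Fin dy) ℝ

section Loops

variable {dx du dy dη : ℕ} (P : Plant dx du dy)

/-- The plant and controller states `(x_t, s_t)` when the LDC `π` is executed. -/
def ldcState (π : LDC dy du) : ℕ → Vec dx × Vec π.dim
  | 0 => (P.x₀, 0)
  | t + 1 =>
    let x := (ldcState π t).1
    let s := (ldcState π t).2
    let y := act P.C x + P.e t
    let u := act π.C s + act π.D y
    (act P.A x + act P.B u + P.w t, act π.A s + act π.B y)

/-- The sequence `(y^π_t, u^π_t)` produced by the LDC `π`. -/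
def ldcOut (π : LDC dy du) (t : ℕ) : OutVec dy du :=
  let x := (ldcState P π t).1
  let s := (ldcState P π t).2
  let y := act P.C x + P.e t
  stack y (act π.C s + act π.D y)

/-- The states `(x_t, s_t)` under the nominal controller with exogenous inputs `uex`. -/
def nomState (π₀ : NominalController dy du dη) (uex : ℕ → Vec du) :
    ℕ → Vec dx × Vec π₀.dim
  | 0 => (P.x₀, 0)
  | t + 1 =>
    let x := (nomState π₀ uex t).1
    let s := (nomState π₀ uex t).2
    let y := act P.C x + P.e t
    let u := act π₀.C s + act π₀.D y + uex t
    (act P.A x + act P.B u + P.w t, act π₀.A s + act π₀.B y + act π₀.Bu (uex t))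

/-- The outputs `(y_t, u_t)` under the nominal controller with exogenous inputs `uex`. -/
def nomOut (π₀ : NominalController dy du dη) (uex : ℕ → Vec du) (t : ℕ) : OutVec dy du :=
  let x := (nomState P π₀ uex t).1
  let s := (nomState P π₀ uex t).2
  let y := act P.C x + P.e t
  stack y (act π₀.C s + act π₀.D y + uex t)

/-- The features `η_t` under the nominal controller with exogenous inputs `uex`. -/
def nomFeature (π₀ : NominalController dy du dη) (uex : ℕ → Vec du) (t : ℕ) : Vec dη :=
  let x := (nomState P π₀ uex t).1
  let s := (nomState P π₀ uex t).2
  act π₀.Cη s + act π₀.Dη (act P.C x + P.e t)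

/-- Nature's outputs `vⁿᵃᵗ_t = (yⁿᵃᵗ_t, uⁿᵃᵗ_t)`: no exogenous input. -/
def natOut (π₀ : NominalController dy du dη) : ℕ → OutVec dy du := nomOut P π₀ 0

/-- Nature's features `ηⁿᵃᵗ_t`: no exogenous input. -/
def natFeature (π₀ : NominalController dy du dη) : ℕ → Vec dη := nomFeature P π₀ 0

/-- State matrix of the interconnection of the plant with `π₀`. -/
def clA (π₀ : NominalController dy du dη) :
    Matrix (Fin dx ⊕ Fin π₀.dim) (Fin dx ⊕ Fin π₀.dim) ℝ :=
  Matrix.fromBlocks (P.A + P.B * π₀.D * P.C) (P.B * π₀.C) (π₀.B * P.C) π₀.A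

/-- Input matrix of the interconnection of the plant with `π₀`. -/
def clB (π₀ : NominalController dy du dη) : Matrix (Fin dx ⊕ Fin π₀.dim) (Fin du) ℝ :=
  Matrix.fromRows P.B π₀.Bu

/-- The Markov operator `G_{ex→v}` from exogenous inputs to `v = (y, u)`. -/
def exToOut (π₀ : NominalController dy du dη) : Markov (Fin dy ⊕ Fin du) (Fin du)
  | 0 => Matrix.fromRows 0 1
  | i + 1 => Matrix.fromBlocks P.C 0 (π₀.D * P.C) π₀.C * clA P π₀ ^ i * clB P π₀

/-- The Markov operator `G_{ex→η}` from exogenous inputs to features. -/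
def exToFeature (π₀ : NominalController dy du dη) : Markov (Fin dη) (Fin du)
  | 0 => 0
  | i + 1 => Matrix.fromCols (π₀.Dη * P.C) π₀.Cη * clA P π₀ ^ i * clB P π₀

/-- The plant state `x_t` under static feedback `u_t = K y_t + uᵉˣ_t`. -/
def staticState (K : Matrix (Fin du) (Fin dy) ℝ) (uex : ℕ → Vec du) : ℕ → Vec dx
  | 0 => P.x₀
  | t + 1 =>
    let x := staticState K uex t
    let u := act K (act P.C x + P.e t) + uex t
    act P.A x + act P.B u + P.w t

/-- The measurement `y_t` under static feedback `u_t = K y_t + uᵉˣ_t`. -/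
def staticY (K : Matrix (Fin du) (Fin dy) ℝ) (uex : ℕ → Vec du) (t : ℕ) : Vec dy :=
  act P.C (staticState P K uex t) + P.e t

/-- The outputs `(y_t, u_t)` under static feedback `u_t = K y_t + uᵉˣ_t`. -/
def staticOut (K : Matrix (Fin du) (Fin dy) ℝ) (uex : ℕ → Vec du) (t : ℕ) : OutVec dy du :=
  stack (staticY P K uex t) (act K (staticY P K uex t) + uex t)

/-- The Markov operator `G_K` from exogenous inputs to `(y, u)` under static feedback `K`. -/
def staticMarkov (K : Matrix (Fin du) (Fin dy) ℝ) : Markov (Fin dy ⊕ Fin du) (Fin du)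
  | 0 => Matrix.fromRows 0 1
  | i + 1 => Matrix.fromRows P.C (K * P.C) * (P.A + P.B * K * P.C) ^ i * P.B

end Loops

/-! ### Disturbance response control -/

/-- Parameters `M = (M^{[0]}, …, M^{[m-1]})`. -/
abbrev Param (m du dη : ℕ) : Type := Fin m → Matrix (Fin du) (Fin dη) ℝ

/-- The set `{M : ∑_{i < m} ‖M^{[i]}‖ ≤ R}`. -/
def drcSet (m du dη : ℕ) (R : ℝ) : Set (Param m du dη) := {M | ∑ i, ‖M i‖ ≤ R}

/-- The input `uᵉˣ_t(M ∣ η) = ∑_{i < m} M^{[i]} η_{t-i}`, features before the first round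
being zero. -/
def drcInput {m du dη : ℕ} (M : Param m du dη) (η : ℕ → Vec dη) (t : ℕ) : Vec du :=
  ∑ i : Fin m, if (i : ℕ) ≤ t then act (M i) (η (t - i)) else 0

section Algorithm

variable {dx du dy dη m : ℕ} (P : Plant dx du dy)

/-- Feature recovery: the observed features minus the predicted effect `∑_{i=1}^{t} G^{[i]} u_{t-i}`
of the earlier exogenous inputs. -/
def recover (G : Markov (Fin dη) (Fin du)) (ηobs : ℕ → Vec dη) (uex : ℕ → Vec du) (t : ℕ) :
    Vec dη :=
  ηobs t - ∑ i ∈ Finset.Icc 1 t, act (G i) (uex (t - i))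

/-- The exogenous inputs played by the algorithm around the nominal controller `π₀`, with Markov
operator `Ghat` for the features and iterates `M t`.  In round `t` the features observed up to
now (which depend on the inputs of the earlier rounds only) are corrected to `ηhat`, and
`∑_{i < m} M_t^{[i]} ηhat_{t-i}` is played. -/
def algInput (π₀ : NominalController dy du dη) (Ghat : Markov (Fin dη) (Fin du))
    (M : ℕ → Param m du dη) (t : ℕ) : Vec du :=
  let past : ℕ → Vec du := fun j => if _h : j < t then algInput π₀ Ghat M j else 0
  let ηhat : ℕ → Vec dη := recover Ghat (nomFeature P π₀ past) past
  drcInput (M t) ηhat t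
termination_by t

/-- The outputs `(y_t, u_t)` of the algorithm around `π₀`. -/
def algOut (π₀ : NominalController dy du dη) (Ghat : Markov (Fin dη) (Fin du))
    (M : ℕ → Param m du dη) : ℕ → OutVec dy du :=
  nomOut P π₀ (algInput P π₀ Ghat M)

/-- The exogenous inputs played by the static-feedback algorithm: the features are the
measurements `y`, corrected by means of the `y`-rows of the Markov operator `Ghat`. -/
def staticAlgInput (K : Matrix (Fin du) (Fin dy) ℝ) (Ghat : Markov (Fin dy ⊕ Fin du) (Fin du))
    (M : ℕ → Param m du dy) (t : ℕ) : Vec du :=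
  let past : ℕ → Vec du := fun j => if _h : j < t then staticAlgInput K Ghat M j else 0
  let yhat : ℕ → Vec dy := recover (fun i => (Ghat i).toRows₁) (staticY P K past) past
  drcInput (M t) yhat t
termination_by t

/-- The outputs `(y_t, u_t)` of the static-feedback algorithm. -/
def staticAlgOut (K : Matrix (Fin du) (Fin dy) ℝ) (Ghat : Markov (Fin dy ⊕ Fin du) (Fin du))
    (M : ℕ → Param m du dy) : ℕ → OutVec dy du :=
  staticOut P K (staticAlgInput P K Ghat M)

end Algorithm

/-! ### Regret -/

section Regret

variable {dx du dy dη m : ℕ}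

/-- `G` converts the nominal controller into `π`: fed with the inputs `∑_{i ≤ t} G^{[t-i]} η_i`,
where `η` are nature's features, the nominal closed loop (nature's outputs `vnat`, Markov
operator `Gv`) reproduces the outputs of `π`. -/
def IsConversion (P : Plant dx du dy) (vnat : ℕ → OutVec dy du)
    (Gv : Markov (Fin dy ⊕ Fin du) (Fin du)) (η : ℕ → Vec dη) (π : LDC dy du)
    (G : Markov (Fin du) (Fin dη)) : Prop :=
  ∀ t, ldcOut P π t = vnat t + response Gv (response G η) t

/-- The comparator class `Π_stab(R, ψ)`: the LDCs with a conversion operator of `ℓ₁,op` norm at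
most `R` and decay function at most `ψ`. -/
def stabClass (P : Plant dx du dy) (vnat : ℕ → OutVec dy du)
    (Gv : Markov (Fin dy ⊕ Fin du) (Fin du)) (η : ℕ → Vec dη) (R : ℝ) (ψ : ℕ → ℝ) :
    Set (LDC dy du) :=
  {π | ∃ G : Markov (Fin du) (Fin dη), IsConversion P vnat Gv η π G ∧
    l1op G ≤ ENNReal.ofReal R ∧ ∀ n, decay G n ≤ ENNReal.ofReal (ψ n)}

/-- `ControlReg_T`: the cumulative loss of the outputs `v` minus that of the best LDC in `Pi`. -/
def controlReg (P : Plant dx du dy) (ℓ : ℕ → OutVec dy du → ℝ) (T : ℕ)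
    (v : ℕ → OutVec dy du) (Pi : Set (LDC dy du)) : ℝ :=
  ∑ t ∈ Finset.range T, ℓ t (v t) -
    sInf ((fun π => ∑ t ∈ Finset.range T, ℓ t (ldcOut P π t)) '' Pi)

/-- The parameter space of vectors `z`, of dimension `m · du · dη`. -/
abbrev ZSpace (m du dη : ℕ) : Type := EuclideanSpace ℝ (Fin m × Fin du × Fin dη)

/-- The embedding `M ↦ z` that lists the entries of `M`. -/
def embed (M : Param m du dη) : ZSpace m du dη :=
  WithLp.toLp 2 (fun p => M p.1 p.2.1 p.2.2)

/-- The matrix `Y_t` with `Y_t (embed M) = uᵉˣ_t(M ∣ η)`. -/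
def featureMatrix (m du : ℕ) (η : ℕ → Vec dη) (t : ℕ) :
    Matrix (Fin du) (Fin m × Fin du × Fin dη) ℝ :=
  fun a p => if a = p.2.1 ∧ (p.1 : ℕ) ≤ t then η (t - p.1) p.2.2 else 0

/-- The loss with memory `F_t(z_{t:t-h} ∣ η) = ℓ_t(vnat_t + ∑_{i ≤ h} G^{[i]} Y_{t-i} z_{t-i})`,
with `Y_s = 0` before the first round.  Of the sequence `z` only `z_t, …, z_{t-h}` enter. -/
def memLoss (ℓ : ℕ → OutVec dy du → ℝ) (vnat : ℕ → OutVec dy du)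
    (Gv : Markov (Fin dy ⊕ Fin du) (Fin du)) (η : ℕ → Vec dη) (h t : ℕ)
    (z : ℕ → ZSpace m du dη) : ℝ :=
  ℓ t (vnat t + ∑ i ∈ Finset.range (h + 1),
    if i ≤ t then act (Gv i) (act (featureMatrix m du η (t - i)) (z (t - i))) else 0)

/-- The unary specialization `f_t(z ∣ η) = F_t(z, …, z ∣ η)`. -/
def unaryLoss (ℓ : ℕ → OutVec dy du → ℝ) (vnat : ℕ → OutVec dy du)
    (Gv : Markov (Fin dy ⊕ Fin du) (Fin du)) (η : ℕ → Vec dη) (h t : ℕ)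
    (z : ZSpace m du dη) : ℝ :=
  memLoss ℓ vnat Gv η h t (fun _ => z)

/-- `MemoryReg_T` of the iterates `z_t = embed (M t)`, against the best fixed `z` in the embedded
parameter set of radius `R`. -/
def memoryReg (ℓ : ℕ → OutVec dy du → ℝ) (vnat : ℕ → OutVec dy du)
    (Gv : Markov (Fin dy ⊕ Fin du) (Fin du)) (η : ℕ → Vec dη) (h T : ℕ) (R : ℝ)
    (M : ℕ → Param m du dη) : ℝ :=
  ∑ t ∈ Finset.range T, memLoss ℓ vnat Gv η h t (fun s => embed (M s)) -
    sInf ((fun z => ∑ t ∈ Finset.range T, unaryLoss ℓ vnat Gv η h t z) ''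
      (embed '' drcSet m du dη R))

end Regret

end DRC

end

open DRC

/-!
By superposition, a closed loop driven by exogenous inputs outputs `vⁿᵃᵗ + G_{ex→v} ∗ uᵉˣ`.  Since
the algorithm knows the Markov operator of its features, it recovers nature's features exactly,
so that its outputs are `vⁿᵃᵗ + G_{ex→v} ∗ uᵉˣ(M_t ∣ ηⁿᵃᵗ)`; the loss with memory replaces
`G_{ex→v}` by its first `h + 1` terms, which moves the output by at most `ψ_{π₀}(h + 1)` times the
size of the inputs.  A comparator with conversion operator `G` is matched by the parameter
`(G^{[0]}, …, G^{[m-1]})`, at the cost of a second truncation error `ψ_⋆(m)`.  Subquadratic losses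
are Lipschitz on the ball containing all these outputs, so each truncation costs `O(1 / T)` per
round.
-/

namespace DRC

section MatrixAction

variable {a b c d : ℕ}

theorem act_apply {ι κ : Type*} [Fintype ι] [DecidableEq ι] [Fintype κ] [DecidableEq κ]
    (A : Matrix ι κ ℝ) (x : EuclideanSpace ℝ κ) (i : ι) : act A x i = ∑ j, A i j * x j :=
  rfl

theorem stack_add (y y' : Vec a) (u u' : Vec b) :
    stack (y + y') (u + u') = stack y u + stack y' u' := by
  ext (i | i) <;> rfl

theorem act_fromBlocks_stack (A : Matrix (Fin a) (Fin c) ℝ) (B : Matrix (Fin a) (Fin d) ℝ)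
    (C : Matrix (Fin b) (Fin c) ℝ) (D : Matrix (Fin b) (Fin d) ℝ) (x : Vec c) (s : Vec d) :
    act (Matrix.fromBlocks A B C D) (stack x s) =
      stack (act A x + act B s) (act C x + act D s) := by
  ext i
  exact congrFun (Matrix.fromBlocks_mulVec A B C D _) i

theorem act_fromCols_stack (A : Matrix (Fin a) (Fin c) ℝ) (B : Matrix (Fin a) (Fin d) ℝ)
    (x : Vec c) (s : Vec d) :
    act (Matrix.fromCols A B) (stack x s) = act A x + act B s := by
  ext i
  exact congrFun (Matrix.fromCols_mulVec_sumElim A B x s) i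

theorem act_fromRows (A : Matrix (Fin a) (Fin c) ℝ) (B : Matrix (Fin b) (Fin c) ℝ) (x : Vec c) :
    act (Matrix.fromRows A B) x = stack (act A x) (act B x) := by
  ext (i | i) <;> rfl

theorem norm_stack_sq (y : Vec a) (u : Vec b) : ‖stack y u‖ ^ 2 = ‖y‖ ^ 2 + ‖u‖ ^ 2 := by
  simp only [EuclideanSpace.norm_sq_eq, Fintype.sum_sum_type]
  rfl

theorem norm_fst_le_norm_stack (y : Vec a) (u : Vec b) : ‖y‖ ≤ ‖stack y u‖ :=
  le_of_sq_le_sq (by simp [norm_stack_sq]) (norm_nonneg _)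

theorem norm_snd_le_norm_stack (y : Vec a) (u : Vec b) : ‖u‖ ≤ ‖stack y u‖ :=
  le_of_sq_le_sq (by simp [norm_stack_sq]) (norm_nonneg _)

theorem one_le_norm_fromRows_one [Nonempty (Fin b)] (A : Matrix (Fin a) (Fin b) ℝ) :
    1 ≤ ‖Matrix.fromRows A (1 : Matrix (Fin b) (Fin b) ℝ)‖ := by
  let u : Vec b := EuclideanSpace.single (Classical.arbitrary _) 1
  have hu : ‖u‖ = 1 := by simp [u]
  let E : Matrix (Fin a ⊕ Fin b) (Fin b) ℝ := Matrix.fromRows A 1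
  have hact : act E u = stack (act A u) u := by
    rw [act_fromRows, act, act, Matrix.toLpLin_one, LinearMap.id_apply]
  calc 1 = ‖u‖ := hu.symm
    _ ≤ ‖act E u‖ := hact ▸ norm_snd_le_norm_stack _ _
    _ ≤ ‖E‖ * ‖u‖ := Matrix.l2_opNorm_mulVec E u
    _ = ‖E‖ := by rw [hu, mul_one]

end MatrixAction

section Response

variable {ι κ τ : Type*} [Fintype ι] [DecidableEq ι] [Fintype κ] [DecidableEq κ]
  [Fintype τ] [DecidableEq τ]

theorem response_eq_sum_range (G : Markov ι κ) (u : ℕ → EuclideanSpace ℝ κ) (t : ℕ) :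
    response G u t = ∑ i ∈ Finset.range (t + 1), act (G i) (u (t - i)) := by
  rw [response, ← Finset.sum_flip]
  refine Finset.sum_congr rfl fun i hi => ?_
  rw [Nat.sub_sub_self (Finset.mem_range_succ_iff.1 hi)]

theorem response_succ (G : Markov ι κ) (u : ℕ → EuclideanSpace ℝ κ) (t : ℕ) :
    response G u (t + 1) = response (fun i => G (i + 1)) u t + act (G 0) (u (t + 1)) := by
  rw [response, Finset.sum_range_succ, Nat.sub_self, response]
  congr 1
  refine Finset.sum_congr rfl fun i hi => ?_
  rw [Nat.succ_sub (Finset.mem_range_succ_iff.1 hi)]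

theorem response_const_mul (C : Matrix τ ι ℝ) (G : Markov ι κ) (u : ℕ → EuclideanSpace ℝ κ)
    (t : ℕ) : response (fun i => C * G i) u t = act C (response G u t) := by
  simp [response, act]

theorem response_sub_markov (G H : Markov ι κ) (u : ℕ → EuclideanSpace ℝ κ) (t : ℕ) :
    response (G - H) u t = response G u t - response H u t := by
  simp [response, act]

theorem response_sub_input (G : Markov ι κ) (u v : ℕ → EuclideanSpace ℝ κ) (t : ℕ) :
    response G (u - v) t = response G u t - response G v t := by
  simp [response]

theorem response_zero_markov (u : ℕ → EuclideanSpace ℝ κ) :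
    response (0 : Markov ι κ) u = 0 := by
  funext t
  simp [response, act]

theorem response_zero_input (G : Markov ι κ) : response G 0 = 0 := by
  funext t
  simp [response]

theorem state_succ_eq_response {A : Matrix τ τ ℝ} {B : Matrix τ κ ℝ}
    {X : ℕ → EuclideanSpace ℝ τ} {u : ℕ → EuclideanSpace ℝ κ} (h0 : X 0 = 0)
    (hX : ∀ t, X (t + 1) = act A (X t) + act B (u t)) (t : ℕ) :
    X (t + 1) = response (fun i => A ^ i * B) u t := by
  induction t with
  | zero => simp [response, hX, h0]
  | succ t ih =>
    rw [hX, ih, response_succ, ← response_const_mul]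
    simp [pow_succ', Matrix.mul_assoc]

theorem response_eq_output {G : Markov ι κ} {A : Matrix τ τ ℝ} {B : Matrix τ κ ℝ}
    {C : Matrix ι τ ℝ} (hG : ∀ i, G (i + 1) = C * A ^ i * B)
    {X : ℕ → EuclideanSpace ℝ τ} {u : ℕ → EuclideanSpace ℝ κ} (h0 : X 0 = 0)
    (hX : ∀ t, X (t + 1) = act A (X t) + act B (u t)) (t : ℕ) :
    response G u t = act C (X t) + act (G 0) (u t) := by
  cases t with
  | zero => simp [response, h0]
  | succ t =>
    simp only [response_succ, hG, Matrix.mul_assoc]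
    rw [response_const_mul, state_succ_eq_response h0 hX]

/-- `G` is the Markov operator (impulse response) of the system `S` from inputs to outputs, in the
presence of fixed disturbances: the output is that of the undriven system plus the response of
`G`. -/
def HasMarkovOperator (S : (ℕ → EuclideanSpace ℝ κ) → ℕ → EuclideanSpace ℝ ι)
    (G : Markov ι κ) : Prop :=
  ∀ u t, S u t = S 0 t + response G u t

theorem hasMarkovOperator_of_stateSpace
    {S : (ℕ → EuclideanSpace ℝ κ) → ℕ → EuclideanSpace ℝ ι} {G : Markov ι κ}
    {A : Matrix τ τ ℝ} {B : Matrix τ κ ℝ} {C : Matrix ι τ ℝ}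
    (hG : ∀ i, G (i + 1) = C * A ^ i * B)
    {X : (ℕ → EuclideanSpace ℝ κ) → ℕ → EuclideanSpace ℝ τ}
    {w : ℕ → EuclideanSpace ℝ τ} {e : ℕ → EuclideanSpace ℝ ι}
    (h0 : ∀ u, X u 0 = X 0 0) (hX : ∀ u t, X u (t + 1) = act A (X u t) + act B (u t) + w t)
    (hS : ∀ u t, S u t = act C (X u t) + act (G 0) (u t) + e t) : HasMarkovOperator S G := by
  intro u t
  have hdev : ∀ t, X u (t + 1) - X 0 (t + 1) = act A (X u t - X 0 t) + act B (u t) := by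
    intro t
    simp only [hX, Pi.zero_apply, map_zero, map_sub]
    abel
  rw [response_eq_output hG (X := fun t => X u t - X 0 t) (sub_eq_zero.2 (h0 u)) hdev, hS, hS]
  simp only [Pi.zero_apply, map_zero, map_sub]
  abel

end Response

section Truncation

variable {ι κ : Type*}

/-- The finite impulse response operator `(M^{[0]}, …, M^{[n-1]}, 0, 0, …)`. -/
def finMarkov {n : ℕ} (M : Fin n → Matrix ι κ ℝ) : Markov ι κ :=
  fun i => if hi : i < n then M ⟨i, hi⟩ else 0

/-- The Markov operator `(G^{[0]}, …, G^{[n-1]}, 0, 0, …)` of the first `n` terms of `G`. -/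
def truncate (G : Markov ι κ) (n : ℕ) : Markov ι κ := finMarkov fun i : Fin n => G i

theorem truncate_apply (G : Markov ι κ) (n i : ℕ) : truncate G n i = if i < n then G i else 0 := by
  simp [truncate, finMarkov]

variable [Fintype ι] [Fintype κ] [DecidableEq κ]

theorem l1op_finMarkov {n : ℕ} (M : Fin n → Matrix ι κ ℝ) :
    l1op (finMarkov M) = ENNReal.ofReal (∑ i, ‖M i‖) := by
  rw [l1op, tsum_eq_sum (s := Finset.range n) fun i hi => by simp_all [finMarkov],
    ENNReal.ofReal_sum_of_nonneg fun _ _ => norm_nonneg _, ← Fin.sum_univ_eq_sum_range]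
  simp [finMarkov]

theorem l1op_truncate_le (G : Markov ι κ) (n : ℕ) : l1op (truncate G n) ≤ l1op G := by
  refine ENNReal.tsum_le_tsum fun i => ?_
  rw [truncate_apply]
  split_ifs <;> simp

theorem l1op_sub_truncate (G : Markov ι κ) (n : ℕ) : l1op (G - truncate G n) = decay G n := by
  rw [l1op, ← (add_right_injective n).tsum_eq]
  · simp [decay, truncate_apply]
  · intro i hi
    have hni : n ≤ i := by
      by_contra! h
      simp [truncate_apply, h] at hi
    exact ⟨i - n, Nat.add_sub_cancel' hni⟩

theorem l1op_eq_zero_of_isEmpty [IsEmpty κ] (G : Markov ι κ) : l1op G = 0 := by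
  simp [l1op, Subsingleton.elim (G _) 0]

theorem decay_eq_zero_of_isEmpty [IsEmpty κ] (G : Markov ι κ) (n : ℕ) : decay G n = 0 :=
  l1op_eq_zero_of_isEmpty fun i => G (n + i)

theorem le_of_le_norm_of_l1op_le {G : Markov ι κ} {a r : ℝ} (ha : 0 < a) {i : ℕ}
    (hi : a ≤ ‖G i‖) (hG : l1op G ≤ ENNReal.ofReal r) : a ≤ r :=
  (ENNReal.ofReal_le_ofReal_iff'.1 ((ENNReal.ofReal_le_ofReal hi).trans
    ((ENNReal.le_tsum i).trans hG))).resolve_right ha.not_ge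

variable [DecidableEq ι]

theorem response_finMarkov {n : ℕ} (M : Fin n → Matrix ι κ ℝ) (u : ℕ → EuclideanSpace ℝ κ)
    (t : ℕ) : response (finMarkov M) u t =
      ∑ i : Fin n, if (i : ℕ) ≤ t then act (M i) (u (t - i)) else 0 := by
  rw [response_eq_sum_range]
  calc ∑ i ∈ Finset.range (t + 1), act (finMarkov M i) (u (t - i))
      = ∑ i ∈ Finset.range n with i ≤ t, act (finMarkov M i) (u (t - i)) := by
        refine (Finset.sum_subset (by grind) fun i _ hi => ?_).symm
        have hni : ¬ i < n := by grind
        simp [finMarkov, hni, act]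
    _ = ∑ i : Fin n, if (i : ℕ) ≤ t then act (finMarkov M i) (u (t - i)) else 0 := by
        rw [Finset.sum_filter, ← Fin.sum_univ_eq_sum_range]
    _ = ∑ i : Fin n, if (i : ℕ) ≤ t then act (M i) (u (t - i)) else 0 := by simp [finMarkov]

variable {G : Markov ι κ} {u : ℕ → EuclideanSpace ℝ κ} {t n : ℕ} {b r δ : ℝ}

theorem norm_response_le (hr : 0 ≤ r) (hG : l1op G ≤ ENNReal.ofReal r)
    (hu : ∀ s ≤ t, ‖u s‖ ≤ b) : ‖response G u t‖ ≤ r * b := by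
  have hb : 0 ≤ b := (norm_nonneg _).trans (hu t le_rfl)
  have hsum : ∑ i ∈ Finset.range (t + 1), ‖G i‖ ≤ r := by
    rw [← ENNReal.ofReal_le_ofReal_iff hr, ENNReal.ofReal_sum_of_nonneg fun _ _ => norm_nonneg _]
    exact (ENNReal.sum_le_tsum _).trans hG
  rw [response_eq_sum_range]
  calc ‖∑ i ∈ Finset.range (t + 1), act (G i) (u (t - i))‖
      ≤ ∑ i ∈ Finset.range (t + 1), ‖G i‖ * b := norm_sum_le_of_le _ fun i _ =>
        (Matrix.l2_opNorm_mulVec _ _).trans (by gcongr; exact hu _ (Nat.sub_le _ _))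
    _ = (∑ i ∈ Finset.range (t + 1), ‖G i‖) * b := (Finset.sum_mul _ _ _).symm
    _ ≤ r * b := by gcongr

theorem norm_response_sub_response_truncate_le (hδ : 0 ≤ δ) (hG : decay G n ≤ ENNReal.ofReal δ)
    (hu : ∀ s ≤ t, ‖u s‖ ≤ b) : ‖response G u t - response (truncate G n) u t‖ ≤ δ * b := by
  rw [← response_sub_markov]
  exact norm_response_le hδ ((l1op_sub_truncate G n).trans_le hG) hu

theorem norm_response_response_sub_truncate_le {τ : Type*} [Fintype τ] [DecidableEq τ]
    {H : Markov τ ι} {m : ℕ} {r' δ' : ℝ} (hr : 0 ≤ r) (hδ : 0 ≤ δ) (hr' : 0 ≤ r') (hδ' : 0 ≤ δ')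
    (hH : l1op H ≤ ENNReal.ofReal r') (hHn : decay H n ≤ ENNReal.ofReal δ')
    (hG : l1op G ≤ ENNReal.ofReal r) (hGm : decay G m ≤ ENNReal.ofReal δ)
    (hu : ∀ s ≤ t, ‖u s‖ ≤ b) :
    ‖response H (response G u) t - response (truncate H n) (response (truncate G m) u) t‖ ≤
      (δ' * r + r' * δ) * b := by
  calc ‖response H (response G u) t - response (truncate H n) (response (truncate G m) u) t‖
      ≤ ‖response H (response G u) t - response (truncate H n) (response G u) t‖ +
          ‖response (truncate H n) (response G u) t -
            response (truncate H n) (response (truncate G m) u) t‖ :=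
        norm_sub_le_norm_sub_add_norm_sub _ _ _
    _ ≤ δ' * (r * b) + r' * (δ * b) := by
        refine add_le_add
          (norm_response_sub_response_truncate_le hδ' hHn fun s hs => ?_) ?_
        · exact norm_response_le hr hG fun k hk => hu k (hk.trans hs)
        · rw [← response_sub_input]
          exact norm_response_le hr' ((l1op_truncate_le H n).trans hH) fun s hs =>
            norm_response_sub_response_truncate_le hδ hGm fun k hk => hu k (hk.trans hs)
    _ = (δ' * r + r' * δ) * b := by ring

end Truncation

section ClosedLoop

variable {dx du dy dη m : ℕ} (P : Plant dx du dy)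

theorem HasMarkovOperator.recover_eq {S : (ℕ → Vec du) → ℕ → Vec dη} {G : Markov (Fin dη) (Fin du)}
    (hS : HasMarkovOperator S G) (hG : G 0 = 0) (uex : ℕ → Vec du) :
    recover G (S uex) uex = S 0 := by
  funext t
  rw [recover, hS, response_eq_sum_range, Finset.range_eq_Ico,
    Finset.sum_eq_sum_Ico_succ_bot t.succ_pos, hG]
  simp [act, Finset.Ico_add_one_right_eq_Icc]

/-- The plant and controller states under the nominal controller, as one vector: the state of
their interconnection. -/
noncomputable def nomJointState (π₀ : NominalController dy du dη) (uex : ℕ → Vec du) (t : ℕ) :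
    OutVec dx π₀.dim :=
  stack (nomState P π₀ uex t).1 (nomState P π₀ uex t).2

theorem nomJointState_succ (π₀ : NominalController dy du dη) (uex : ℕ → Vec du) (t : ℕ) :
    nomJointState P π₀ uex (t + 1) =
      act (clA P π₀) (nomJointState P π₀ uex t) + act (clB P π₀) (uex t) +
        stack (act P.B (act π₀.D (P.e t)) + P.w t) (act π₀.B (P.e t)) := by
  simp only [nomJointState, nomState, clA, clB, act_fromBlocks_stack, act_fromRows, ← stack_add,
    act, map_add, Matrix.toLpLin_mul_same, LinearMap.add_apply, LinearMap.comp_apply]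
  congr 1 <;> abel

theorem hasMarkovOperator_nomOut (π₀ : NominalController dy du dη) :
    HasMarkovOperator (nomOut P π₀) (exToOut P π₀) := by
  refine hasMarkovOperator_of_stateSpace (fun _ => rfl) (fun _ => rfl) (nomJointState_succ P π₀)
    (e := fun t => stack (P.e t) (act π₀.D (P.e t))) fun u t => ?_
  simp only [nomOut, nomJointState, exToOut, act_fromBlocks_stack, act_fromRows, ← stack_add,
    act, map_add, map_zero, Matrix.toLpLin_mul_same, Matrix.toLpLin_one, LinearMap.zero_apply,
    LinearMap.comp_apply, LinearMap.id_apply]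
  congr 1 <;> abel

theorem hasMarkovOperator_nomFeature (π₀ : NominalController dy du dη) :
    HasMarkovOperator (nomFeature P π₀) (exToFeature P π₀) := by
  refine hasMarkovOperator_of_stateSpace (fun _ => rfl) (fun _ => rfl) (nomJointState_succ P π₀)
    (e := fun t => act π₀.Dη (P.e t)) fun u t => ?_
  simp only [nomFeature, nomJointState, exToFeature, act_fromCols_stack, act, map_add, map_zero,
    Matrix.toLpLin_mul_same, LinearMap.zero_apply, LinearMap.comp_apply]
  abel

theorem algInput_eq_drcInput (π₀ : NominalController dy du dη) (M : ℕ → Param m du dη) (t : ℕ) :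
    algInput P π₀ (exToFeature P π₀) M t = drcInput (M t) (natFeature P π₀) t := by
  rw [algInput]
  exact congrArg (drcInput (M t) · t) ((hasMarkovOperator_nomFeature P π₀).recover_eq rfl _)

theorem algOut_eq (π₀ : NominalController dy du dη) (M : ℕ → Param m du dη) :
    algOut P π₀ (exToFeature P π₀) M = fun t =>
      natOut P π₀ t + response (exToOut P π₀) (fun s => drcInput (M s) (natFeature P π₀) s) t := by
  rw [algOut, funext (algInput_eq_drcInput P π₀ M)]
  exact funext (hasMarkovOperator_nomOut P π₀ _)

theorem staticState_succ (K : Matrix (Fin du) (Fin dy) ℝ) (uex : ℕ → Vec du) (t : ℕ) :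
    staticState P K uex (t + 1) =
      act (P.A + P.B * K * P.C) (staticState P K uex t) + act P.B (uex t) +
        (act P.B (act K (P.e t)) + P.w t) := by
  simp only [staticState, act, map_add, Matrix.toLpLin_mul_same, LinearMap.add_apply,
    LinearMap.comp_apply]
  abel

theorem hasMarkovOperator_staticOut (K : Matrix (Fin du) (Fin dy) ℝ) :
    HasMarkovOperator (staticOut P K) (staticMarkov P K) := by
  refine hasMarkovOperator_of_stateSpace (fun _ => rfl) (fun _ => rfl) (staticState_succ P K)
    (e := fun t => stack (P.e t) (act K (P.e t))) fun u t => ?_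
  simp only [staticOut, staticY, staticMarkov, act_fromRows, ← stack_add, act, map_add, map_zero,
    Matrix.toLpLin_mul_same, Matrix.toLpLin_one, LinearMap.zero_apply, LinearMap.comp_apply,
    LinearMap.id_apply]
  congr 1 <;> abel

theorem hasMarkovOperator_staticY (K : Matrix (Fin du) (Fin dy) ℝ) :
    HasMarkovOperator (staticY P K) fun i => (staticMarkov P K i).toRows₁ := by
  refine hasMarkovOperator_of_stateSpace (C := P.C)
    (fun i => by simp only [staticMarkov, Matrix.fromRows_mul, Matrix.toRows₁_fromRows])
    (fun _ => rfl) (staticState_succ P K) (e := P.e) fun u t => ?_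
  simp [staticY, staticMarkov, act]

theorem staticAlgInput_eq_drcInput (K : Matrix (Fin du) (Fin dy) ℝ) (M : ℕ → Param m du dy)
    (t : ℕ) :
    staticAlgInput P K (staticMarkov P K) M t = drcInput (M t) (staticY P K 0) t := by
  rw [staticAlgInput]
  exact congrArg (drcInput (M t) · t)
    ((hasMarkovOperator_staticY P K).recover_eq (by simp [staticMarkov]) _)

theorem staticAlgOut_eq (K : Matrix (Fin du) (Fin dy) ℝ) (M : ℕ → Param m du dy) :
    staticAlgOut P K (staticMarkov P K) M = fun t => staticOut P K 0 t +
      response (staticMarkov P K) (fun s => drcInput (M s) (staticY P K 0) s) t := by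
  rw [staticAlgOut, funext (staticAlgInput_eq_drcInput P K M)]
  exact funext (hasMarkovOperator_staticOut P K _)

/-- The nominal controller without exogenous inputs, as an LDC: a member of the comparator
class. -/
def NominalController.toLDC (π₀ : NominalController dy du dη) : LDC dy du where
  dim := π₀.dim
  A := π₀.A
  B := π₀.B
  C := π₀.C
  D := π₀.D

theorem ldcState_toLDC (π₀ : NominalController dy du dη) (t : ℕ) :
    ldcState P π₀.toLDC t = nomState P π₀ 0 t := by
  induction t with
  | zero => rfl
  | succ t ih =>
    simp only [ldcState, nomState, ih, Pi.zero_apply, map_zero, add_zero]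
    rfl

theorem ldcOut_toLDC (π₀ : NominalController dy du dη) :
    ldcOut P π₀.toLDC = natOut P π₀ := by
  funext t
  simp only [ldcOut, natOut, nomOut, ldcState_toLDC, Pi.zero_apply, add_zero]
  rfl

/-- The static feedback law `u_t = K y_t`, as an LDC without internal state: a member of the
comparator class. -/
noncomputable def staticLDC (K : Matrix (Fin du) (Fin dy) ℝ) : LDC dy du where
  dim := 0
  A := 0
  B := 0
  C := 0
  D := K

theorem act_staticLDC_C (K : Matrix (Fin du) (Fin dy) ℝ) (s : Vec (staticLDC K).dim) :
    act (staticLDC K).C s = 0 :=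
  LinearMap.congr_fun (map_zero Matrix.toEuclideanLin) s

theorem ldcState_staticLDC_fst (K : Matrix (Fin du) (Fin dy) ℝ) (t : ℕ) :
    (ldcState P (staticLDC K) t).1 = staticState P K 0 t := by
  induction t with
  | zero => rfl
  | succ t ih =>
    simp only [ldcState, staticState, ih, Pi.zero_apply, add_zero, act_staticLDC_C, zero_add]
    rfl

theorem ldcOut_staticLDC (K : Matrix (Fin du) (Fin dy) ℝ) :
    ldcOut P (staticLDC K) = staticOut P K 0 := by
  funext t
  simp only [ldcOut, staticOut, staticY, ldcState_staticLDC_fst, Pi.zero_apply, add_zero,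
    act_staticLDC_C, zero_add]
  rfl

end ClosedLoop

section Parameters

variable {du dy dη m : ℕ}

theorem act_featureMatrix_embed (M : Param m du dη) (η : ℕ → Vec dη) (t : ℕ) :
    act (featureMatrix m du η t) (embed M) = drcInput M η t := by
  ext a
  rw [act_apply, drcInput, WithLp.ofLp_sum, Finset.sum_apply, Fintype.sum_prod_type]
  refine Finset.sum_congr rfl fun i _ => ?_
  rw [Fintype.sum_prod_type, Finset.sum_eq_single a]
  · by_cases hi : (i : ℕ) ≤ t
    · simp [featureMatrix, embed, hi, act_apply, mul_comm]
    · simp [featureMatrix, hi]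
  · intro b _ hb
    simp [featureMatrix, hb.symm]
  · simp

theorem response_finMarkov_eq_drcInput (M : Param m du dη) (η : ℕ → Vec dη) (t : ℕ) :
    response (finMarkov M) η t = drcInput M η t :=
  response_finMarkov M η t

theorem memLoss_embed (ℓ : ℕ → OutVec dy du → ℝ) (vnat : ℕ → OutVec dy du)
    (Gv : Markov (Fin dy ⊕ Fin du) (Fin du)) (η : ℕ → Vec dη) (h t : ℕ)
    (M : ℕ → Param m du dη) :
    memLoss ℓ vnat Gv η h t (fun s => embed (M s)) =
      ℓ t (vnat t + response (truncate Gv (h + 1)) (fun s => drcInput (M s) η s) t) := by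
  simp only [memLoss, truncate, response_finMarkov, act_featureMatrix_embed]
  rw [Fin.sum_univ_eq_sum_range (fun i => if i ≤ t then
    act (Gv i) (drcInput (M (t - i)) η (t - i)) else 0)]

end Parameters


section Regret

theorem IsSubquadratic.const_nonneg {E : Type*} [NormedAddCommGroup E] {L : ℝ} {ℓ : E → ℝ}
    (hℓ : IsSubquadratic L ℓ) : 0 ≤ L := by
  simpa using (hℓ.nonneg 0).trans (hℓ.le 0)

theorem IsSubquadratic.apply_add_le {E : Type*} [NormedAddCommGroup E] {L R r δ : ℝ} {ℓ : E → ℝ}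
    (hℓ : IsSubquadratic L ℓ) {v x x' : E} (hR : 1 ≤ R) (hv : ‖v‖ ≤ R) (hx : ‖x‖ ≤ r)
    (hx' : ‖x'‖ ≤ r) (hδ : ‖x - x'‖ ≤ δ) : ℓ (v + x) ≤ ℓ (v + x') + L * (R + r) * δ := by
  have hL := hℓ.const_nonneg
  have hr : 0 ≤ r := (norm_nonneg x).trans hx
  have hmax : max 1 (max ‖v + x‖ ‖v + x'‖) ≤ R + r :=
    max_le (by linarith) (max_le (norm_add_le_of_le hv hx) (norm_add_le_of_le hv hx'))
  rw [← sub_le_iff_le_add']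
  calc ℓ (v + x) - ℓ (v + x')
      ≤ L * max 1 (max ‖v + x‖ ‖v + x'‖) * ‖v + x - (v + x')‖ :=
        (le_abs_self _).trans (hℓ.lipschitz _ _)
    _ ≤ L * (R + r) * δ := by rw [add_sub_add_left_eq_sub]; gcongr

variable {dx du dy dη m h T t : ℕ} {P : Plant dx du dy} {ℓ : ℕ → OutVec dy du → ℝ}
  {vnat : ℕ → OutVec dy du} {Gv : Markov (Fin dy ⊕ Fin du) (Fin du)} {η : ℕ → Vec dη}
  {L R b r r' δ δ' : ℝ}

theorem mem_drcSet_iff_l1op_finMarkov_le (hr : 0 ≤ r) {M : Param m du dη} :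
    M ∈ drcSet m du dη r ↔ l1op (finMarkov M) ≤ ENNReal.ofReal r := by
  rw [l1op_finMarkov, ENNReal.ofReal_le_ofReal_iff hr]
  rfl

theorem norm_drcInput_le (hr : 0 ≤ r) {M : Param m du dη} (hM : M ∈ drcSet m du dη r)
    (hη : ∀ s ≤ t, ‖η s‖ ≤ b) : ‖drcInput M η t‖ ≤ r * b := by
  rw [← response_finMarkov_eq_drcInput]
  exact norm_response_le hr ((mem_drcSet_iff_l1op_finMarkov_le hr).1 hM) hη

theorem loss_le_memLoss_add (hℓ : IsSubquadratic L (ℓ t)) (hR : 1 ≤ R) (hv : ‖vnat t‖ ≤ R)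
    (hη : ∀ s ≤ t, ‖η s‖ ≤ b) (hr' : 0 ≤ r') (hδ' : 0 ≤ δ') (hGv : l1op Gv ≤ ENNReal.ofReal r')
    (hGvh : decay Gv (h + 1) ≤ ENNReal.ofReal δ') (hr : 0 ≤ r) {M : ℕ → Param m du dη}
    (hM : ∀ s ≤ t, M s ∈ drcSet m du dη r) :
    ℓ t (vnat t + response Gv (fun s => drcInput (M s) η s) t) ≤
      memLoss ℓ vnat Gv η h t (fun s => embed (M s)) +
        L * (R + r' * (r * b)) * (δ' * (r * b)) := by
  have hu : ∀ s ≤ t, ‖drcInput (M s) η s‖ ≤ r * b := fun s hs =>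
    norm_drcInput_le hr (hM s hs) fun k hk => hη k (hk.trans hs)
  rw [memLoss_embed]
  exact hℓ.apply_add_le hR hv (norm_response_le hr' hGv hu)
    (norm_response_le hr' ((l1op_truncate_le _ _).trans hGv) hu)
    (norm_response_sub_response_truncate_le hδ' hGvh hu)

theorem unaryLoss_embed_le_loss_add (hℓ : IsSubquadratic L (ℓ t)) (hR : 1 ≤ R)
    (hv : ‖vnat t‖ ≤ R) (hη : ∀ s ≤ t, ‖η s‖ ≤ b) (hr' : 0 ≤ r') (hδ' : 0 ≤ δ')
    (hGv : l1op Gv ≤ ENNReal.ofReal r') (hGvh : decay Gv (h + 1) ≤ ENNReal.ofReal δ')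
    (hr : 0 ≤ r) (hδ : 0 ≤ δ) {G : Markov (Fin du) (Fin dη)} (hG : l1op G ≤ ENNReal.ofReal r)
    (hGm : decay G m ≤ ENNReal.ofReal δ) :
    unaryLoss ℓ vnat Gv η h t (embed fun i : Fin m => G i) ≤
      ℓ t (vnat t + response Gv (response G η) t) +
        L * (R + r' * (r * b)) * ((δ' * r + r' * δ) * b) := by
  have hbound : ∀ {G' : Markov (Fin du) (Fin dη)}, l1op G' ≤ ENNReal.ofReal r →
      ∀ s ≤ t, ‖response G' η s‖ ≤ r * b := fun hG' s hs =>
    norm_response_le hr hG' fun k hk => hη k (hk.trans hs)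
  have hinput : (fun s => drcInput (fun i : Fin m => G i) η s) = response (truncate G m) η :=
    funext fun s => (response_finMarkov_eq_drcInput _ η s).symm
  rw [unaryLoss, memLoss_embed, hinput]
  refine hℓ.apply_add_le hR hv ?_ (norm_response_le hr' hGv (hbound hG)) ?_
  · exact norm_response_le hr' ((l1op_truncate_le _ _).trans hGv)
      (hbound ((l1op_truncate_le G m).trans hG))
  · rw [norm_sub_rev]
    exact norm_response_response_sub_truncate_le hr hδ hr' hδ' hGv hGvh hG hGm hη

theorem controlReg_le_memoryReg_add_of_forall {v : ℕ → OutVec dy du} {Pi : Set (LDC dy du)}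
    {M : ℕ → Param m du dη} {ε₁ ε₂ : ℝ} (hℓ : ∀ t v, 0 ≤ ℓ t v) (hPi : Pi.Nonempty)
    (halg : ∀ t < T, ℓ t (v t) ≤ memLoss ℓ vnat Gv η h t (fun s => embed (M s)) + ε₁)
    (hcomp : ∀ π ∈ Pi, ∃ N ∈ drcSet m du dη R, ∀ t < T,
      unaryLoss ℓ vnat Gv η h t (embed N) ≤ ℓ t (ldcOut P π t) + ε₂) :
    controlReg P ℓ T v Pi ≤ memoryReg ℓ vnat Gv η h T R M + T * (ε₁ + ε₂) := by
  have hsum : ∀ {f g : ℕ → ℝ} {ε : ℝ}, (∀ t < T, f t ≤ g t + ε) →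
      ∑ t ∈ Finset.range T, f t ≤ ∑ t ∈ Finset.range T, g t + T * ε := by
    intro f g ε hfg
    simpa [Finset.sum_add_distrib] using
      Finset.sum_le_sum fun t ht => hfg t (Finset.mem_range.1 ht)
  have hinf : sInf ((fun z => ∑ t ∈ Finset.range T, unaryLoss ℓ vnat Gv η h t z) ''
      (embed '' drcSet m du dη R)) - T * ε₂ ≤
        sInf ((fun π => ∑ t ∈ Finset.range T, ℓ t (ldcOut P π t)) '' Pi) := by
    refine le_csInf (hPi.image _) ?_
    rintro _ ⟨π, hπ, rfl⟩
    obtain ⟨N, hN, hNπ⟩ := hcomp π hπ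
    rw [sub_le_iff_le_add]
    refine (csInf_le ⟨0, ?_⟩ (Set.mem_image_of_mem _ (Set.mem_image_of_mem _ hN))).trans
      (hsum hNπ)
    rintro _ ⟨z, -, rfl⟩
    exact Finset.sum_nonneg fun t _ => hℓ t _
  rw [controlReg, memoryReg]
  linarith [hsum halg]

theorem mem_stabClass_of_ldcOut_eq {π : LDC dy du} (hπ : ldcOut P π = vnat) (ψ : ℕ → ℝ) :
    π ∈ stabClass P vnat Gv η r ψ := by
  refine ⟨0, fun t => ?_, ?_, fun n => ?_⟩
  · rw [response_zero_markov, response_zero_input, hπ, Pi.zero_apply, add_zero]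
  · simp [l1op]
  · simp [decay]

theorem controlReg_le_memoryReg_add {Rnat R₀ RM Rstar ε : ℝ} {ψstar : ℕ → ℝ}
    (hℓ : ∀ t, IsSubquadratic L (ℓ t)) (hRnat : 1 ≤ Rnat) (hR₀ : 0 ≤ R₀) (hRM : 0 ≤ RM)
    (hε : 0 ≤ ε) (hRstar : Rstar ≤ RM) (hψstar : ψstar m ≤ ε * RM)
    (hGv : l1op Gv ≤ ENNReal.ofReal R₀) (hGvh : decay Gv (h + 1) ≤ ENNReal.ofReal (ε * R₀))
    (hv : ∀ t, ‖vnat t‖ ≤ Rnat) (hη : ∀ t, ‖η t‖ ≤ Rnat)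
    (hPi : (stabClass P vnat Gv η Rstar ψstar).Nonempty)
    {M : ℕ → Param m du dη} (hM : ∀ t < T, M t ∈ drcSet m du dη RM) :
    controlReg P ℓ T (fun t => vnat t + response Gv (fun s => drcInput (M s) η s) t)
        (stabClass P vnat Gv η Rstar ψstar) ≤
      memoryReg ℓ vnat Gv η h T RM M +
        T * (3 * L * ε * (R₀ * RM) * (1 + R₀ * RM) * Rnat ^ 2) := by
  have hreg := controlReg_le_memoryReg_add_of_forall (R := RM) (P := P) (fun t => (hℓ t).nonneg) hPi
    (fun t ht => loss_le_memLoss_add (hℓ t) hRnat (hv t) (fun s _ => hη s) hR₀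
      (by positivity) hGv hGvh hRM fun s hs => hM s (hs.trans_lt ht))
    (ε₂ := L * (Rnat + R₀ * (RM * Rnat)) * ((ε * R₀ * RM + R₀ * (ε * RM)) * Rnat)) ?_
  · convert hreg using 3
    ring
  · rintro π ⟨G, hconv, hG, hGm⟩
    have hG' : l1op G ≤ ENNReal.ofReal RM := hG.trans (ENNReal.ofReal_le_ofReal hRstar)
    refine ⟨fun i => G i, (mem_drcSet_iff_l1op_finMarkov_le hRM).2
      ((l1op_truncate_le G m).trans hG'), fun t _ => ?_⟩
    rw [hconv]
    exact unaryLoss_embed_le_loss_add (hℓ t) hRnat (hv t) (fun s _ => hη s) hR₀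
      (by positivity) hGv hGvh hRM (by positivity) hG'
      ((hGm m).trans (ENNReal.ofReal_le_ofReal hψstar))

theorem controlReg_le_memoryReg_add_of_feedthrough_eq {Rnat R₀ RM Rstar c : ℝ} {ψstar : ℕ → ℝ}
    {A : Matrix (Fin dy) (Fin du) ℝ} (hGv0 : Gv 0 = Matrix.fromRows A 1)
    (hℓ : ∀ t, IsSubquadratic L (ℓ t)) (hT : 1 ≤ T) (hRnat : 1 ≤ Rnat) (hRM : 1 ≤ RM)
    (hRstar : Rstar ≤ RM) (hc : 0 ≤ c) (hψstar : ψstar m ≤ c * Rstar / T)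
    (hGv : l1op Gv ≤ ENNReal.ofReal R₀)
    (hGvh : decay Gv (h + 1) ≤ ENNReal.ofReal (c * R₀ / T))
    (hv : ∀ t, ‖vnat t‖ ≤ Rnat) (hη : ∀ t, ‖η t‖ ≤ Rnat)
    (hPi : (stabClass P vnat Gv η Rstar ψstar).Nonempty)
    {M : ℕ → Param m du dη} (hM : ∀ t < T, M t ∈ drcSet m du dη RM) :
    controlReg P ℓ T (fun t => vnat t + response Gv (fun s => drcInput (M s) η s) t)
        (stabClass P vnat Gv η Rstar ψstar) ≤
      memoryReg ℓ vnat Gv η h T RM M + 6 * L * c * RM ^ 2 * R₀ ^ 2 * Rnat ^ 2 := by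
  have hL : 0 ≤ L := (hℓ 0).const_nonneg
  have hRM₀ : 0 ≤ RM := zero_le_one.trans hRM
  have hT₀ : (T : ℝ) ≠ 0 := by positivity
  have hψstar' : ψstar m ≤ c / T * RM := hψstar.trans (by rw [mul_div_right_comm]; gcongr)
  -- The identity feedthrough forces `1 ≤ R₀`, unless the inputs are zero-dimensional.
  rcases isEmpty_or_nonempty (Fin du) with hdu | hdu
  · have hreg := controlReg_le_memoryReg_add (R₀ := 0) (h := h) hℓ hRnat le_rfl hRM₀
      (by positivity) hRstar hψstar'
      ((l1op_eq_zero_of_isEmpty Gv).trans_le zero_le)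
      ((decay_eq_zero_of_isEmpty Gv _).trans_le zero_le) hv hη hPi hM
    refine hreg.trans (add_le_add_right ?_ _)
    simp only [zero_mul, mul_zero]
    positivity
  · have hR₀ : 1 ≤ R₀ := le_of_le_norm_of_l1op_le one_pos
      (hGv0 ▸ one_le_norm_fromRows_one A) hGv
    rw [mul_div_right_comm] at hGvh
    refine (controlReg_le_memoryReg_add hℓ hRnat (by positivity) hRM₀ (by positivity) hRstar
      hψstar' hGv hGvh hv hη hPi hM).trans (add_le_add_right ?_ _)
    have hone : 1 ≤ R₀ * RM := one_le_mul_of_one_le_of_one_le hR₀ hRM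
    calc T * (3 * L * (c / T) * (R₀ * RM) * (1 + R₀ * RM) * Rnat ^ 2)
        ≤ T * (3 * L * (c / T) * (R₀ * RM) * (R₀ * RM + R₀ * RM) * Rnat ^ 2) := by gcongr
      _ = 6 * L * c * RM ^ 2 * R₀ ^ 2 * Rnat ^ 2 := by field_simp; ring

end Regret

end DRC

theorem mainTheorem7_general {dx du dy : ℕ} (P : Plant dx du dy)
    (ℓ : ℕ → OutVec dy du → ℝ) (L : ℝ) (hℓ : ∀ t, IsSubquadratic L (ℓ t))
    (T m h : ℕ) (hT : 1 ≤ T) (Rnat R₀ Rstar RM c : ℝ) (ψstar : ℕ → ℝ)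
    (hRnat : 1 ≤ Rnat) (hRM : 1 ≤ RM) (hRstar : Rstar ≤ RM) (hc : 0 ≤ c)
    (hm : ψstar m ≤ c * Rstar / T) :
    (∀ (dη : ℕ) (π₀ : NominalController dy du dη),
      l1op (exToOut P π₀) ≤ ENNReal.ofReal R₀ →
      decay (exToOut P π₀) (h + 1) ≤ ENNReal.ofReal (c * R₀ / T) →
      (∀ t, ‖natOut P π₀ t‖ ≤ Rnat) →
      (∀ t, ‖natFeature P π₀ t‖ ≤ Rnat) →
      ∀ M : ℕ → Param m du dη, (∀ t < T, M t ∈ drcSet m du dη RM) →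
        controlReg P ℓ T (algOut P π₀ (exToFeature P π₀) M)
            (stabClass P (natOut P π₀) (exToOut P π₀) (natFeature P π₀) Rstar ψstar) ≤
          memoryReg ℓ (natOut P π₀) (exToOut P π₀) (natFeature P π₀) h T RM M
            + 6 * L * c * RM ^ 2 * R₀ ^ 2 * Rnat ^ 2) ∧
    (∀ K : Matrix (Fin du) (Fin dy) ℝ,
      l1op (staticMarkov P K) ≤ ENNReal.ofReal R₀ →
      decay (staticMarkov P K) (h + 1) ≤ ENNReal.ofReal (c * R₀ / T) →
      (∀ t, ‖staticOut P K 0 t‖ ≤ Rnat) →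
      ∀ M : ℕ → Param m du dy, (∀ t < T, M t ∈ drcSet m du dy RM) →
        controlReg P ℓ T (staticAlgOut P K (staticMarkov P K) M)
            (stabClass P (staticOut P K 0) (staticMarkov P K) (staticY P K 0) Rstar ψstar) ≤
          memoryReg ℓ (staticOut P K 0) (staticMarkov P K) (staticY P K 0) h T RM M
            + 6 * L * c * RM ^ 2 * R₀ ^ 2 * Rnat ^ 2) := by
  constructor
  · intro dη π₀ hG hGh hv hη M hM
    rw [algOut_eq]
    exact controlReg_le_memoryReg_add_of_feedthrough_eq rfl hℓ hT hRnat hRM hRstar hc hm hG hGh hv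
      hη ⟨_, mem_stabClass_of_ldcOut_eq (ldcOut_toLDC P π₀) ψstar⟩ hM
  · intro K hG hGh hv M hM
    rw [staticAlgOut_eq]
    have hy : ∀ t, ‖staticY P K 0 t‖ ≤ Rnat := fun t => (norm_fst_le_norm_stack _ _).trans (hv t)
    exact controlReg_le_memoryReg_add_of_feedthrough_eq rfl hℓ hT hRnat hRM hRstar hc hm hG hGh hv
      hy ⟨_, mem_stabClass_of_ldcOut_eq (ldcOut_staticLDC P K) ψstar⟩ hM

theorem mainTheorem7 {dx du dy : ℕ} (P : Plant dx du dy)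
    (ℓ : ℕ → OutVec dy du → ℝ) (L : ℝ) (hℓ : ∀ t, IsSubquadratic L (ℓ t))
    (T m h : ℕ) (hT : 1 ≤ T)
    (Rnat R₀ Rstar RM c : ℝ) (ψ₀ ψstar : ℕ → ℝ)
    (hRnat : 1 ≤ Rnat) (hRM : 1 ≤ RM) (hRstar : Rstar ≤ RM) (hc : 0 < c)
    (hψ₀ : IsDecayFunction ψ₀) (hψstar : IsDecayFunction ψstar)
    (hm : ψstar m ≤ c * Rstar / T) (hh : ψ₀ (h + 1) ≤ c * R₀ / T) :
    -- the algorithm around a dynamic nominal controller `π₀`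
    (∀ (dη : ℕ) (π₀ : NominalController dy du dη),
      l1op (exToOut P π₀) ≤ ENNReal.ofReal R₀ →
      l1op (exToFeature P π₀) ≤ ENNReal.ofReal R₀ →
      (∀ n, decay (exToOut P π₀) n ≤ ENNReal.ofReal (ψ₀ n)) →
      (∀ n, decay (exToFeature P π₀) n ≤ ENNReal.ofReal (ψ₀ n)) →
      (∀ t, ‖natOut P π₀ t‖ ≤ Rnat) →
      (∀ t, ‖natFeature P π₀ t‖ ≤ Rnat) →
      ∀ M : ℕ → Param m du dη, (∀ t < T, M t ∈ drcSet m du dη RM) →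
        controlReg P ℓ T (algOut P π₀ (exToFeature P π₀) M)
            (stabClass P (natOut P π₀) (exToOut P π₀) (natFeature P π₀) Rstar ψstar) ≤
          memoryReg ℓ (natOut P π₀) (exToOut P π₀) (natFeature P π₀) h T RM M
            + 12 * L * c * RM ^ 2 * R₀ ^ 2 * Rnat ^ 2) ∧
    -- the algorithm around a static feedback law `K`
    (∀ K : Matrix (Fin du) (Fin dy) ℝ,
      l1op (staticMarkov P K) ≤ ENNReal.ofReal R₀ →
      (∀ n, decay (staticMarkov P K) n ≤ ENNReal.ofReal (ψ₀ n)) →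
      (∀ t, ‖staticOut P K 0 t‖ ≤ Rnat) →
      ∀ M : ℕ → Param m du dy, (∀ t < T, M t ∈ drcSet m du dy RM) →
        controlReg P ℓ T (staticAlgOut P K (staticMarkov P K) M)
            (stabClass P (staticOut P K 0) (staticMarkov P K) (staticY P K 0) Rstar ψstar) ≤
          memoryReg ℓ (staticOut P K 0) (staticMarkov P K) (staticY P K 0) h T RM M
            + 12 * L * c * RM ^ 2 * R₀ ^ 2 * Rnat ^ 2) := by
  have hL : 0 ≤ L := (hℓ 0).const_nonneg
  have hbound : 6 * L * c * RM ^ 2 * R₀ ^ 2 * Rnat ^ 2 ≤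
      12 * L * c * RM ^ 2 * R₀ ^ 2 * Rnat ^ 2 := by
    gcongr
    norm_num
  obtain ⟨hdyn, hstatic⟩ := mainTheorem7_general P ℓ L hℓ T m h hT Rnat R₀ Rstar RM c ψstar
    hRnat hRM hRstar hc.le hm
  have hhor := ENNReal.ofReal_le_ofReal hh
  exact ⟨fun dη π₀ hG _ hd _ hv hη M hM =>
      (hdyn dη π₀ hG ((hd _).trans hhor) hv hη M hM).trans (by gcongr),
    fun K hG hd hv M hM => (hstatic K hG ((hd _).trans hhor) hv M hM).trans (by gcongr)⟩
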